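/- Let $\mathcal F$ (decisions) and $\mathcal Z$ (outcomes) be arbitrary sets and $\ell:\mathcal F\times\mathcal Z\to\mathbb R$ a loss function (with $\mathcal F$ a measurable space and $\ell(\cdot,z)$ measurable for every $z$). Fix a number of rounds $T$. A strategy is a sequence $\pi=(\pi_t)_{t=1}^T$ of maps $\pi_t:\mathcal Z^{t-1}\to\mathcal F$; let $\Pi$ be any non-empty set of strategies. Constraints are predicates $C_t$ on $\mathcal Z^t$, $t=1,\dots,T$; in round $t$ the adversary may only play $z_t$ such that $C_t(z_1,\dots,z_t)$ holds. Let $\mathcal Q$ be the set of probability distributions on $\mathcal F$ for which the losses $\ell(\cdot,z)$, $z\in\mathcal Z$, are integrable (all distributions if $\ell$ is bounded). The value of the game (minimax regret) is, in $[-\infty,\infty]$, $$\mathcal V_T(\Pi,C)=\inf_{q_1\in\mathcal Q}\ \sup_{z_1:\,C_1(z_1)}\ \mathbb E_{f_1\sim q_1}\cdots\inf_{q_T\in\mathcal Q}\ \sup_{z_T:\,C_T(z_1,\dots,z_T)}\ \mathbb E_{f_T\sim q_T}\Big[\sum_{t=1}^T\ell(f_t,z_t)-\inf_{\pi\in\Pi}\sum_{t=1}^T\ell(\pi_t(z_1,\dots,z_{t-1}),z_t)\Big].$$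 Let $\epsilon_1,\epsilon_2,\dots$ be independent uniform signs in $\{\pm1\}$. A $\mathcal Z$-valued tree of depth $T$ is a sequence of maps $\mathbf z_t:\{\pm1\}^{t-1}\to\mathcal Z$, $t=1,\dots,T$; a history tree of depth $T$ is a sequence of maps $\mathbf w_s:\{\pm1\}^{s}\to\mathcal Z$, $s=1,\dots,T$. Write $\mathbf z_t(\epsilon)=\mathbf z_t(\epsilon_1,\dots,\epsilon_{t-1})$ and $\mathbf w_s(\epsilon)=\mathbf w_s(\epsilon_1,\dots,\epsilon_s)$, so that the outcome $\mathbf z_t(\epsilon)$ and the history $(\mathbf w_1(\epsilon),\dots,\mathbf w_{t-1}(\epsilon))$ before round $t$ are both functions of $\epsilon_1,\dots,\epsilon_{t-1}$. The sequential Rademacher complexity of $\Pi$ is $$\mathfrak R(\ell,\Pi,C)=\sup_{\mathbf w,\mathbf z}\ \mathbb E_\epsilon\sup_{\pi\in\Pi}\sum_{t=1}^T\epsilon_t\,\ell\big(\pi_t(\mathbf w_1(\epsilon),\dots,\mathbf w_{t-1}(\epsilon)),\mathbf z_t(\epsilon)\big),$$ the supremum being over all $\mathcal Z$-valued trees $\mathbf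 z$ and, independently of $\mathbf z$, over all history trees $\mathbf w$ that satisfy $C_t(\mathbf w_1(\epsilon),\dots,\mathbf w_t(\epsilon))$ for all $\epsilon$ and all $t\le T$. **Theorem.** (i) $\mathcal V_T(\Pi,C)\le 2\,\mathfrak R(\ell,\Pi,C)$. In particular, without constraints, $\mathcal V_T(\Pi)\le 2\,\mathfrak R(\ell,\Pi)$, where both trees are arbitrary. (ii) Suppose that the game has $T=n+1$ rounds and that no loss is suffered in the first round (the sums over $t$ in the value start at $t=2$). Then $$\mathcal V_{n+1}(\Pi,C)\le 2\sup_{\mathbf w,\mathbf z}\ \mathbb E_{\epsilon_1,\dots,\epsilon_n}\sup_{\pi\in\Pi}\sum_{t=1}^{n}\epsilon_t\,\ell\big(\pi_{t+1}(\mathbf w_1(\epsilon),\dots,\mathbf w_t(\epsilon)),\mathbf z_t(\epsilon)\big),$$ where $\mathbf w$ and $\mathbf z$ are $\mathcal Z$-valued trees of depths $n+1$ and $n$ (labels $\mathbf w_t(\epsilon)=\mathbf w_t(\epsilon_1,\dots,\epsilon_{t-1})$ and $\mathbf z_t(\epsilon)=\mathbf z_t(\epsilon_1,\dots,\epsilon_{t-1})$),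 $\mathbf z$ is arbitrary and $\mathbf w$ satisfies $C_t(\mathbf w_1(\epsilon),\dots,\mathbf w_t(\epsilon))$ for all $\epsilon$ and all $t\le n+1$. The same holds without constraints, with arbitrary $\mathbf w$. -/

import Mathlib

open MeasureTheory
open scoped ENNReal

noncomputable section

namespace OnlineGame

variable {F Z : Type*} {T n m : ℕ}

/-! ### Strategies, constraints, regret

Rounds are indexed by `t : Fin T`, so `t = 0` is the first round and round `t` is preceded by
`t` earlier rounds. -/

/-- The part of a sequence of length `T` that precedes round `t`. -/
def past (x : Fin T → Z) (t : Fin T) : Fin t → Z :=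
  fun s => x ⟨s, s.isLt.trans t.isLt⟩

/-- The part of a sequence of length `T` up to and including round `t`. -/
def upTo (x : Fin T → Z) (t : Fin T) : Fin (t + 1) → Z :=
  fun s => x ⟨s, lt_of_lt_of_le s.isLt t.isLt⟩

/-- A strategy: for every round a map from the past outcomes to a decision. -/
abbrev Strategy (F Z : Type*) (T : ℕ) := (t : Fin T) → (Fin t → Z) → F

/-- A sequence of constraints: for every round a predicate on the outcomes so far, the current
one included. -/
abbrev Constraints (Z : Type*) (T : ℕ) := (t : Fin T) → (Fin (t + 1) → Z) → Prop

/-- The absence of constraints. -/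
def unconstrained (Z : Type*) (T : ℕ) : Constraints Z T := fun _ _ => True

/-- A sequence of outcomes obeys the constraints in every round. -/
def Constraints.Obeyed (C : Constraints Z T) (x : Fin T → Z) : Prop :=
  ∀ t, C t (upTo x t)

/-- Cumulative loss of the decisions `f` on the outcomes `z`, where `ℓ t` is the loss function
of round `t`. -/
def cumLoss (ℓ : Fin T → F → Z → ℝ) (f : Fin T → F) (z : Fin T → Z) : ℝ :=
  ∑ t, ℓ t (f t) (z t)

/-- The decisions that a strategy makes along a sequence of outcomes. -/
def Strategy.play (π : Strategy F Z T) (z : Fin T → Z) : Fin T → F :=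
  fun t => π t (past z t)

/-- Regret with respect to a set of strategies (`⊤` if the comparators' losses are unbounded
below). -/
def regret (ℓ : Fin T → F → Z → ℝ) (S : Set (Strategy F Z T))
    (f : Fin T → F) (z : Fin T → Z) : EReal :=
  ((cumLoss ℓ f z : ℝ) : EReal) - ⨅ π ∈ S, ((cumLoss ℓ (π.play z) z : ℝ) : EReal)

/-! ### The value of the game -/

/-- Expectation of an extended-real-valued function: the integral of the positive part minus the
integral of the negative part. -/
def expect [MeasurableSpace F] (q : Measure F) (X : F → EReal) : EReal :=
  ((∫⁻ f, (X f).toENNReal ∂q : ℝ≥0∞) : EReal) - ((∫⁻ f, (-X f).toENNReal ∂q : ℝ≥0∞) : EReal)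

/-- The mixed decisions: the probability distributions on `F` under which the losses have an
expectation. For a bounded measurable loss these are all probability distributions on `F`. -/
def mixed [MeasurableSpace F] (ℓ : Fin T → F → Z → ℝ) : Set (Measure F) :=
  {q | IsProbabilityMeasure q ∧ ∀ t z, Integrable (fun f => ℓ t f z) q}

/-- The repeated operator
`inf_{q₁ ∈ Q} sup_{z₁} E_{f₁ ∼ q₁} ⋯ inf_{q_T ∈ Q} sup_{z_T} E_{f_T ∼ q_T} Φ(f₁,…,f_T, z₁,…,z_T)`,
in which `z_t` ranges over the outcomes with `C_t(z₁,…,z_t)`. -/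
def multiMinimax [MeasurableSpace F] (Q : Set (Measure F)) :
    (T : ℕ) → Constraints Z T → ((Fin T → F) → (Fin T → Z) → EReal) → EReal
  | 0, _, Φ => Φ Fin.elim0 Fin.elim0
  | T + 1, C, Φ =>
      ⨅ q ∈ Q, ⨆ (z : Z) (_ : C 0 (fun _ => z)),
        expect q fun f =>
          multiMinimax Q T
            (fun t h => C t.succ (Fin.cons (α := fun _ => Z) z h))
            (fun fs zs => Φ (Fin.cons (α := fun _ => F) f fs) (Fin.cons (α := fun _ => Z) z zs))

/-- The value of the game against a set of strategies, for an adversary bound by `C`. -/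
def value [MeasurableSpace F] (ℓ : Fin T → F → Z → ℝ) (S : Set (Strategy F Z T))
    (C : Constraints Z T) : EReal :=
  multiMinimax (mixed ℓ) T C (regret ℓ S)

/-! ### Trees and sequential Rademacher complexity

Signs are Booleans, `true` for `+1` and `false` for `-1`. -/

/-- The real number `±1` coded by a Boolean. -/
def sgn (b : Bool) : ℝ := if b then 1 else -1

/-- Expectation over `m` independent Rademacher signs. -/
def signMean (X : (Fin m → Bool) → EReal) : EReal :=
  ((((2 : ℝ) ^ m)⁻¹ : ℝ) : EReal) * ∑ ε, X ε

/-- A `Z`-valued tree of depth `T`: the `t`-th node is labelled by a function of the `t - 1`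
signs that lead to it. -/
abbrev Tree (Z : Type*) (T : ℕ) := (t : Fin T) → (Fin t → Bool) → Z

/-- The labels along a path `ε`; the last level needs one sign less than the depth. -/
def Tree.path (z : Tree Z T) (h : T ≤ m + 1) (ε : Fin m → Bool) : Fin T → Z :=
  fun t => z t (fun i => ε ⟨i, by have := i.isLt; have := t.isLt; omega⟩)

/-- A history tree of depth `T`: the `s`-th outcome of the history is a function of the first `s`
signs, so that the history `(w₁, …, w_{t-1})` that precedes round `t` is, like the `t`-th label of
a tree, a function of the first `t - 1` signs. Equivalently a `Z`-valued tree of depth `T + 1`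
with an empty root. -/
abbrev HistoryTree (Z : Type*) (T : ℕ) := (s : Fin T) → (Fin (s + 1) → Bool) → Z

/-- The outcomes along a path `ε` of a history tree. -/
def HistoryTree.path (w : HistoryTree Z T) (ε : Fin T → Bool) : Fin T → Z :=
  fun s => w s (upTo ε s)

/-- Sequential Rademacher complexity
`sup_{w, z} E_ε sup_{π ∈ S} ∑_t ε_t ℓ_t(π_t(w₁(ε), …, w_{t-1}(ε)), z_t(ε))`, over the history
trees `w` that obey the constraints along every path and over all `Z`-valued trees `z`. -/
def seqRademacher (ℓ : Fin T → F → Z → ℝ) (S : Set (Strategy F Z T))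
    (C : Constraints Z T) : EReal :=
  ⨆ (w : HistoryTree Z T) (_ : ∀ ε, C.Obeyed (w.path ε)) (z : Tree Z T),
    signMean fun ε : Fin T → Bool =>
      ⨆ π ∈ S, ((∑ t, sgn (ε t) * ℓ t (π.play (w.path ε) t) (z.path T.le_succ ε t) : ℝ) : EReal)

/-! ### No loss in the first round -/

/-- The loss `ℓ` in every round except the first, where no loss is suffered. -/
def freeFirst (ℓ : F → Z → ℝ) : Fin (n + 1) → F → Z → ℝ :=
  Fin.cons (α := fun _ => F → Z → ℝ) (fun _ _ => 0) (fun _ => ℓ)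

/-- Sequential Rademacher complexity of a game with rounds `1, …, n + 1` without loss in the first
round. There is one sign for each of the `n` rounds with a loss, `w` and `z` are both `Z`-valued
trees along these signs, and the root of `w` is the outcome of the first round:
`sup_{w, z} E_ε sup_{π ∈ S} ∑_{t ≤ n} ε_t ℓ(π_{t+1}(w₁(ε), …, w_t(ε)), z_t(ε))`. -/
def seqRademacherFreeFirst (ℓ : F → Z → ℝ) (S : Set (Strategy F Z (n + 1)))
    (C : Constraints Z (n + 1)) : EReal :=
  ⨆ (w : Tree Z (n + 1)) (_ : ∀ ε : Fin n → Bool, C.Obeyed (w.path le_rfl ε)) (z : Tree Z n),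
    signMean fun ε : Fin n → Bool =>
      ⨆ π ∈ S, ((∑ t : Fin n,
        sgn (ε t) * ℓ (π.play (w.path le_rfl ε) t.succ) (z.path n.le_succ ε t) : ℝ) : EReal)

end OnlineGame

end

noncomputable section

namespace OnlineGame

variable {F Z ι : Type*} {T n : ℕ}

/-! No minimax theorem is used: the learner gets an explicit, nearly optimal mixed decision. A
playout of the remaining rounds consists of a history tree, a loss tree and a choice `σ` of
comparator along each path; losses already suffered enter as offsets `φ`. The claim, by induction on
the number of rounds, is that a bound on all playout means bounds the game
(`multiMinimax_le_of_playoutMean_le`).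

Let `v k` be the mean of a continuation `k`, its current outcome included, and `E_k` the mean over
the signs of the loss on `y` of the first decision of the selected comparator. Joining `k` and `k'`
under a root label `y` gives `(v k + v k') / 2 + E_k - E_k' ≤ r` (`playoutMean_branch`,
`playoutMean_add_mul`). The learner takes `k₀` with `v k₀` within `δ` of the supremum and plays the
first decision of its selected comparator. When `x` is revealed, put `y = x`: any continuation `k'`
after `x` has `v k' < v k₀ + δ`, hence `v k' - E_k' + E_k₀ ≤ r + δ`, which is what the induction
needs. -/

/-! ### Prepending a round -/

/-- The constraints on the remaining rounds after the first outcome `z`. -/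
abbrev Constraints.after (C : Constraints Z (T + 1)) (z : Z) : Constraints Z T :=
  fun t h => C t.succ (Fin.cons (α := fun _ => Z) z h)

/-- The strategy for the remaining rounds after the first outcome `z`. -/
def Strategy.after (π : Strategy F Z (T + 1)) (z : Z) : Strategy F Z T :=
  fun t h => π t.succ (Fin.cons (α := fun _ => Z) z h)

/-- The first decision of a strategy. -/
def Strategy.first (π : Strategy F Z (T + 1)) : F := π 0 Fin.elim0

theorem past_cons_succ (z : Z) (h : Fin T → Z) (t : Fin T) :
    past (Fin.cons (α := fun _ => Z) z h) t.succ =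
      Fin.cons (α := fun _ => Z) z (past h t) := by
  funext s
  refine Fin.cases ?_ (fun s => ?_) s <;> rfl

theorem upTo_cons_zero (z : Z) (h : Fin T → Z) :
    upTo (Fin.cons (α := fun _ => Z) z h) 0 = fun _ => z := by
  funext s
  have hs : s = 0 := Subsingleton.elim (α := Fin 1) s 0
  subst hs
  rfl

theorem upTo_cons_succ (z : Z) (h : Fin T → Z) (t : Fin T) :
    upTo (Fin.cons (α := fun _ => Z) z h) t.succ =
      Fin.cons (α := fun _ => Z) z (upTo h t) := by
  funext s
  refine Fin.cases ?_ (fun s => ?_) s <;> rfl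

theorem Constraints.obeyed_cons {C : Constraints Z (T + 1)} {z : Z} {h : Fin T → Z}
    (hz : C 0 fun _ => z) (hh : (C.after z).Obeyed h) :
    C.Obeyed (Fin.cons (α := fun _ => Z) z h) := by
  intro t
  refine Fin.cases ?_ (fun t => ?_) t
  · rw [upTo_cons_zero]; exact hz
  · rw [upTo_cons_succ]; exact hh t

theorem Strategy.play_cons_zero (π : Strategy F Z (T + 1)) (z : Z) (h : Fin T → Z) :
    π.play (Fin.cons (α := fun _ => Z) z h) 0 = π.first :=
  congrArg (π 0) (funext fun s => s.elim0)

theorem Strategy.play_cons_succ (π : Strategy F Z (T + 1)) (z : Z) (h : Fin T → Z) (t : Fin T) :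
    π.play (Fin.cons (α := fun _ => Z) z h) t.succ = (π.after z).play h t :=
  congrArg (π t.succ) (past_cons_succ z h t)

/-- The history tree whose first outcome `x b` and whose continuation `w b` depend on the first
sign `b`. -/
def HistoryTree.branch (x : Bool → Z) (w : Bool → HistoryTree Z T) : HistoryTree Z (T + 1) :=
  Fin.cases (fun e => x (e 0)) fun s e => w (e 0) s fun i => e i.succ

/-- The tree with root `x` and subtrees `z b`. -/
def Tree.branch (x : Z) (z : Bool → Tree Z T) : Tree Z (T + 1) :=
  Fin.cases (fun _ => x) fun t e => z (e ⟨0, t.succ_pos⟩) t fun i => e i.succ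

/-- A history tree with a deterministic outcome prepended, as a tree. -/
def HistoryTree.withRoot (x : Z) (w : HistoryTree Z T) : Tree Z (T + 1) :=
  Fin.cases (fun _ => x) fun s e => w s e

theorem HistoryTree.path_branch (x : Bool → Z) (w : Bool → HistoryTree Z T) (b : Bool)
    (ε : Fin T → Bool) :
    (HistoryTree.branch x w).path (Fin.cons (α := fun _ => Bool) b ε) =
      Fin.cons (α := fun _ => Z) (x b) ((w b).path ε) := by
  funext s
  refine Fin.cases ?_ (fun s => ?_) s <;> rfl

theorem Tree.path_branch (x : Z) (z : Bool → Tree Z T) (b : Bool) (ε : Fin T → Bool) :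
    (Tree.branch x z).path (T + 1).le_succ (Fin.cons (α := fun _ => Bool) b ε) =
      Fin.cons (α := fun _ => Z) x ((z b).path T.le_succ ε) := by
  funext s
  refine Fin.cases ?_ (fun s => ?_) s <;> rfl

theorem HistoryTree.path_withRoot (x : Z) (w : HistoryTree Z T) (ε : Fin T → Bool) :
    (w.withRoot x).path le_rfl ε = Fin.cons (α := fun _ => Z) x (w.path ε) := by
  funext s
  refine Fin.cases ?_ (fun s => ?_) s <;> rfl

theorem sum_signs_succ (X : (Fin (T + 1) → Bool) → ℝ) :
    ∑ ε, X ε = ∑ ε : Fin T → Bool, X (Fin.cons (α := fun _ => Bool) true ε) +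
      ∑ ε : Fin T → Bool, X (Fin.cons (α := fun _ => Bool) false ε) := by
  rw [← (Fin.consEquiv fun _ : Fin (T + 1) => Bool).sum_comp X, Fintype.sum_prod_type,
    Fintype.sum_bool]
  rfl

/-! ### Playouts -/

/-- The mean over the signs of the symmetrised comparator term, for comparators `d i` with offsets
`φ i` of which `σ` selects one along every path. -/
def playoutMean (ℓ : F → Z → ℝ) (d : ι → Strategy F Z T) (φ : ι → ℝ) (w : HistoryTree Z T)
    (z : Tree Z T) (σ : (Fin T → Bool) → ι) : ℝ :=
  ((2 : ℝ) ^ T)⁻¹ * ∑ ε, (φ (σ ε) +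
    2 * ∑ t, sgn (ε t) * ℓ ((d (σ ε)).play (w.path ε) t) (z.path T.le_succ ε t))

/-- The selection `σ` is fixed rather than optimised, so the mean is affine in the offsets; a
supremum over comparators would not be. -/
theorem playoutMean_add_mul (ℓ : F → Z → ℝ) (d : ι → Strategy F Z T) (φ ψ : ι → ℝ) (c : ℝ)
    (w : HistoryTree Z T) (z : Tree Z T) (σ : (Fin T → Bool) → ι) :
    playoutMean ℓ d (fun i => φ i + c * ψ i) w z σ =
      playoutMean ℓ d φ w z σ + c * (((2 : ℝ) ^ T)⁻¹ * ∑ ε, ψ (σ ε)) := by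
  simp only [playoutMean, Finset.sum_add_distrib, ← Finset.mul_sum]
  ring

/-- Conditioning on the first sign turns its term `±2ℓ` into an offset for the remaining rounds. -/
theorem playoutMean_branch (ℓ : F → Z → ℝ) (d : ι → Strategy F Z (T + 1)) (φ : ι → ℝ)
    (x : Bool → Z) (w : Bool → HistoryTree Z T) (y : Z) (z : Bool → Tree Z T)
    (σ : Bool → (Fin T → Bool) → ι) :
    playoutMean ℓ d φ (HistoryTree.branch x w) (Tree.branch y z)
        (fun ε => σ (ε 0) fun t => ε t.succ) =
      (playoutMean ℓ (fun i => (d i).after (x true)) (fun i => φ i + 2 * ℓ (d i).first y)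
          (w true) (z true) (σ true) +
        playoutMean ℓ (fun i => (d i).after (x false)) (fun i => φ i + (-2) * ℓ (d i).first y)
          (w false) (z false) (σ false)) / 2 := by
  simp only [playoutMean, sum_signs_succ, Fin.sum_univ_succ, HistoryTree.path_branch,
    Tree.path_branch, Strategy.play_cons_zero, Strategy.play_cons_succ, Fin.cons_zero,
    Fin.cons_succ, pow_succ, mul_inv]
  simp only [sgn, if_true, Bool.false_eq_true, if_false]
  rw [mul_add, add_div]
  congr 1
  · rw [mul_right_comm, div_eq_mul_inv]
    congr 2
    refine Finset.sum_congr rfl fun ε _ => ?_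
    ring
  · rw [mul_right_comm, div_eq_mul_inv]
    congr 2
    refine Finset.sum_congr rfl fun ε _ => ?_
    ring

/-! ### Expectations -/

section Expect

variable [MeasurableSpace F]

/-- Lower integrals are monotone for arbitrary functions, so the value of the remaining game need
not be measurable in `f`. -/
theorem expect_mono (q : Measure F) {X Y : F → EReal} (h : ∀ f, X f ≤ Y f) :
    expect q X ≤ expect q Y := by
  refine EReal.sub_le_sub ?_ ?_
  · exact EReal.coe_ennreal_le_coe_ennreal_iff.2
      (lintegral_mono fun f => EReal.toENNReal_le_toENNReal (h f))
  · exact EReal.coe_ennreal_le_coe_ennreal_iff.2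
      (lintegral_mono fun f => EReal.toENNReal_le_toENNReal (EReal.neg_le_neg_iff.2 (h f)))

theorem expect_coe {q : Measure F} {g : F → ℝ} (hg : Integrable g q) :
    expect q (fun f => (g f : EReal)) = ((∫ f, g f ∂q : ℝ) : EReal) := by
  have key : ∀ {k : F → ℝ}, Integrable k q → ∫⁻ f, ENNReal.ofReal (k f) ∂q ≠ ⊤ := fun hk =>
    ((lintegral_mono fun f => Real.ofReal_le_enorm _).trans_lt hk.2).ne
  rw [integral_eq_lintegral_pos_part_sub_lintegral_neg_part hg, EReal.coe_sub,
    EReal.coe_ennreal_toReal (key hg), EReal.coe_ennreal_toReal (by exact key hg.neg)]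
  rfl

/-- The law of `g ε` for uniform signs `ε`. -/
def signLaw {m : ℕ} (g : (Fin m → Bool) → F) : Measure F :=
  ∑ ε, ((2 : ℝ≥0∞) ^ m)⁻¹ • Measure.dirac (g ε)

instance {m : ℕ} (g : (Fin m → Bool) → F) : IsProbabilityMeasure (signLaw g) := by
  constructor
  simp only [signLaw, Measure.coe_finsetSum, Finset.sum_apply, Measure.smul_apply,
    measure_univ, smul_eq_mul, mul_one, Finset.sum_const, Finset.card_univ, Fintype.card_fun,
    Fintype.card_bool, Fintype.card_fin, nsmul_eq_mul, Nat.cast_pow, Nat.cast_ofNat]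
  exact ENNReal.mul_inv_cancel (by simp) (by simp)

theorem integrable_signLaw {m : ℕ} (g : (Fin m → Bool) → F) {k : F → ℝ} (hk : Measurable k) :
    Integrable k (signLaw g) := by
  refine integrable_finsetSum_measure.2 fun ε _ => Integrable.smul_measure ?_ (by simp)
  exact ⟨hk.aestronglyMeasurable, by
    simp [HasFiniteIntegral, lintegral_dirac' _ hk.enorm]⟩

theorem integral_signLaw {m : ℕ} (g : (Fin m → Bool) → F) {k : F → ℝ} (hk : Measurable k) :
    ∫ f, k f ∂signLaw g = ((2 : ℝ) ^ m)⁻¹ * ∑ ε, k (g ε) := by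
  rw [signLaw, integral_finsetSum_measure fun ε _ =>
    Integrable.smul_measure ⟨hk.aestronglyMeasurable, by
      simp [HasFiniteIntegral, lintegral_dirac' _ hk.enorm]⟩ (by simp)]
  simp only [integral_smul_measure, integral_dirac' _ _ hk.stronglyMeasurable, Finset.mul_sum]
  simp

theorem signLaw_mem_mixed {m : ℕ} (g : (Fin m → Bool) → F) {ℓ : Fin T → F → Z → ℝ}
    (hℓ : ∀ t z, Measurable fun f => ℓ t f z) : signLaw g ∈ mixed ℓ :=
  ⟨inferInstance, fun t z => integrable_signLaw g (hℓ t z)⟩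

end Expect

/-! ### The playout bound -/

/-- In a game whose payoff is dominated by the regret against comparators `d i` with offsets
`φ i`, the learner can guarantee any bound on all playout means: it plays the first decision of
the comparator selected in a nearly optimal playout. -/
theorem multiMinimax_le_of_playoutMean_le [MeasurableSpace F] [Nonempty ι] {ℓ : F → Z → ℝ}
    (hℓ : ∀ z, Measurable fun f => ℓ f z) {Q : Set (Measure F)}
    (hQ : ∀ (m : ℕ) (g : (Fin m → Bool) → F), signLaw g ∈ Q) :
    ∀ (T : ℕ) (C : Constraints Z T) (d : ι → Strategy F Z T) (φ : ι → ℝ)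
      (Φ : (Fin T → F) → (Fin T → Z) → EReal) (r : ℝ),
      (∀ fs zs (B : ℝ), (∀ i, φ i - cumLoss (fun _ => ℓ) ((d i).play zs) zs ≤ B) →
        Φ fs zs ≤ ((cumLoss (fun _ => ℓ) fs zs + B : ℝ) : EReal)) →
      (∀ w : HistoryTree Z T, (∀ ε, C.Obeyed (w.path ε)) → ∀ z σ, playoutMean ℓ d φ w z σ ≤ r) →
      multiMinimax Q T C Φ ≤ (r : EReal) := by
  intro T
  induction T with
  | zero =>
    intro C d φ Φ r hΦ hr
    have h := hΦ Fin.elim0 Fin.elim0 r fun i => by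
      simpa [playoutMean, cumLoss] using
        hr (fun s => s.elim0) (fun _ t => t.elim0) (fun s => s.elim0) fun _ => i
    simpa [multiMinimax, cumLoss] using h
  | succ T ih =>
    intro C d φ Φ r hΦ hr
    -- It suffices to find, for every margin, a good mixed decision.
    suffices H : ∀ δ : ℝ, 0 < δ → ∃ (m : ℕ) (g : (Fin m → Bool) → F),
        ∀ x, C 0 (fun _ => x) → ∀ w : HistoryTree Z T, (∀ ε, (C.after x).Obeyed (w.path ε)) →
          ∀ z σ, playoutMean ℓ (fun i => (d i).after x) (fun i => φ i + (-1) * ℓ (d i).first x)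
            w z σ + ((2 : ℝ) ^ m)⁻¹ * ∑ ε, ℓ (g ε) x ≤ r + δ by
      refine EReal.le_of_forall_lt_iff_le.1 fun s hs => ?_
      obtain ⟨m, g, hg⟩ := H (s - r) (sub_pos.2 (EReal.coe_lt_coe_iff.1 hs))
      rw [multiMinimax]
      refine (iInf₂_le (signLaw g) (hQ m g)).trans (iSup₂_le fun x hx => ?_)
      set c : ℝ := ((2 : ℝ) ^ m)⁻¹ * ∑ ε, ℓ (g ε) x with hc
      have hint : Integrable (fun f => ℓ f x + (s - c)) (signLaw g) :=
        integrable_signLaw g ((hℓ x).add_const _)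
      have hval : ∫ f, (ℓ f x + (s - c)) ∂signLaw g = s := by
        rw [integral_add (integrable_signLaw g (hℓ x)) (integrable_const _),
          integral_signLaw g (hℓ x), ← hc]
        simp
      refine (expect_mono _ fun f => ?_).trans
        ((expect_coe hint).trans (congrArg _ hval)).le
      -- The loss `ℓ f x` just suffered becomes a common offset; the target `ℓ f x + (s - c)` has
      -- mean `s`.
      refine ih (C.after x) (fun i => (d i).after x)
        (fun i => (φ i + (-1) * ℓ (d i).first x) + ℓ f x * 1) _ _ ?_ ?_
      · intro fs zs B hB
        refine (hΦ (Fin.cons (α := fun _ => F) f fs) (Fin.cons (α := fun _ => Z) x zs)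
          (B - ℓ f x) fun i => ?_).trans (le_of_eq ?_)
        · have := hB i
          simp only [cumLoss, Fin.sum_univ_succ, Strategy.play_cons_zero,
            Strategy.play_cons_succ, Fin.cons_zero, Fin.cons_succ] at this ⊢
          linarith
        · simp only [cumLoss, Fin.sum_univ_succ, Fin.cons_zero, Fin.cons_succ]
          congr 1
          ring
      · intro w hw z σ
        rw [playoutMean_add_mul ℓ _ _ (fun _ => 1)]
        have h1 : ((2 : ℝ) ^ T)⁻¹ * ∑ _ε : Fin T → Bool, (1 : ℝ) = 1 := by simp
        rw [h1]
        have := hg x hx w hw z σ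
        linarith
    intro δ hδ
    -- Playouts of the remaining rounds, together with the outcome of the current round.
    let K : Type _ := {k : Z × HistoryTree Z T × Tree Z T × ((Fin T → Bool) → ι) //
      C 0 (fun _ => k.1) ∧ ∀ ε, (C.after k.1).Obeyed (k.2.1.path ε)}
    let v : K → (ι → ℝ) → ℝ := fun k ψ =>
      playoutMean ℓ (fun i => (d i).after k.1.1) ψ k.1.2.1 k.1.2.2.1 k.1.2.2.2
    -- The loss tree is unconstrained, so `y` is independent of the outcomes with which `k` and `k'`
    -- start.
    have hv : ∀ (k k' : K) (y : Z), (v k (fun i => φ i + 2 * ℓ (d i).first y) +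
        v k' (fun i => φ i + (-2) * ℓ (d i).first y)) / 2 ≤ r := by
      intro k k' y
      refine (playoutMean_branch ℓ d φ (fun b => if b then k.1.1 else k'.1.1)
        (fun b => if b then k.1.2.1 else k'.1.2.1) y
        (fun b => if b then k.1.2.2.1 else k'.1.2.2.1)
        (fun b => if b then k.1.2.2.2 else k'.1.2.2.2)).symm.le.trans (hr _ (fun ε => ?_) _ _)
      rw [← Fin.cons_self_tail ε, HistoryTree.path_branch]
      cases ε 0
      · exact Constraints.obeyed_cons k'.2.1 (k'.2.2 _)
      · exact Constraints.obeyed_cons k.2.1 (k.2.2 _)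
    rcases isEmpty_or_nonempty K with hK | hK
    -- The adversary has no admissible continuation, so any decision works.
    · refine ⟨0, fun _ => (d (Classical.arbitrary ι)).first, fun x hx w hw z σ => ?_⟩
      exact hK.elim ⟨(x, w, z, σ), hx, hw⟩
    · have hbdd : BddAbove (Set.range fun k => v k φ) := by
        refine ⟨r, ?_⟩
        rintro _ ⟨k, rfl⟩
        -- With the same continuation on both sides the `±2` offsets cancel.
        have := hv k k k.1.1
        simp only [v, playoutMean_add_mul] at this ⊢
        linarith
      -- The supremum runs over the current outcome too, so `k₀` is chosen before `x` is known.
      obtain ⟨k₀, hk₀⟩ := exists_lt_of_lt_ciSup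
        (show (⨆ k, v k φ) - δ < ⨆ k, v k φ by linarith)
      refine ⟨T, fun ε => (d (k₀.1.2.2.2 ε)).first, fun x hx w hw z σ => ?_⟩
      have h1 := le_ciSup hbdd (⟨(x, w, z, σ), hx, hw⟩ : K)
      have h2 := hv k₀ ⟨(x, w, z, σ), hx, hw⟩ x
      simp only [v, playoutMean_add_mul] at h1 h2 hk₀ ⊢
      linarith

/-! ### From playouts to regret and Rademacher complexity -/

theorem regret_le {ℓ : Fin T → F → Z → ℝ} {S : Set (Strategy F Z T)} {f : Fin T → F}
    {z : Fin T → Z} {B : ℝ} (h : ∀ π : S, 0 - cumLoss ℓ (π.1.play z) z ≤ B) :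
    regret ℓ S f z ≤ ((cumLoss ℓ f z + B : ℝ) : EReal) := by
  have h1 : ((-B : ℝ) : EReal) ≤ ⨅ π ∈ S, ((cumLoss ℓ (π.play z) z : ℝ) : EReal) :=
    le_iInf₂ fun π hπ => EReal.coe_le_coe_iff.2 (by linarith [h ⟨π, hπ⟩])
  refine (EReal.sub_le_sub le_rfl h1).trans (le_of_eq ?_)
  rw [← EReal.coe_sub, sub_neg_eq_add]

/-- A selection of comparators bounds the mean of the supremum from below. -/
theorem coe_mean_le_signMean {m : ℕ} {κ : Type*} {S : Set κ} (X : κ → (Fin m → Bool) → ℝ)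
    (σ : (Fin m → Bool) → S) :
    ((((2 : ℝ) ^ m)⁻¹ * ∑ ε, X (σ ε) ε : ℝ) : EReal) ≤
      signMean fun ε => ⨆ π ∈ S, ((X π ε : ℝ) : EReal) := by
  have hsum : ((∑ ε, X (σ ε) ε : ℝ) : EReal) = ∑ ε, ((X (σ ε) ε : ℝ) : EReal) :=
    map_sum (⟨⟨Real.toEReal, EReal.coe_zero⟩, EReal.coe_add⟩ : ℝ →+ EReal) _ _
  rw [signMean, EReal.coe_mul, hsum]
  refine mul_le_mul_of_nonneg_left (Finset.sum_le_sum fun ε _ => ?_)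
    (EReal.coe_nonneg.2 (by positivity))
  exact le_iSup₂_of_le (σ ε).1 (σ ε).2 le_rfl

/-- Twice the mean for a selection of comparators is a playout mean without offsets. -/
theorem playoutMean_zero_le {S : Set ι} {ℓ : F → Z → ℝ} {d : ι → Strategy F Z T}
    {w : HistoryTree Z T} {z : Tree Z T} {R : EReal} {r : ℝ} (hr : 2 * R ≤ (r : EReal))
    (hR : (signMean fun ε => ⨆ π ∈ S, ((∑ t, sgn (ε t) *
      ℓ ((d π).play (w.path ε) t) (z.path T.le_succ ε t) : ℝ) : EReal)) ≤ R)
    (σ : (Fin T → Bool) → S) :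
    playoutMean ℓ (fun π : S => d π) (fun _ => 0) w z σ ≤ r := by
  have h := (coe_mean_le_signMean (S := S) (fun π ε => ∑ t, sgn (ε t) *
      ℓ ((d π).play (w.path ε) t) (z.path T.le_succ ε t)) σ).trans hR
  have h2 := (mul_le_mul_of_nonneg_left h (by norm_num : (0 : EReal) ≤ 2)).trans hr
  rw [show (2 : EReal) = ((2 : ℝ) : EReal) from rfl, ← EReal.coe_mul, EReal.coe_le_coe_iff] at h2
  simp only [playoutMean, zero_add, ← Finset.mul_sum]
  linarith

theorem value_le_two_mul_seqRademacher [MeasurableSpace F] {ℓ : F → Z → ℝ}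
    (hℓ : ∀ z, Measurable fun f => ℓ f z)
    {S : Set (Strategy F Z T)} (hS : S.Nonempty) (C : Constraints Z T) :
    value (fun _ => ℓ) S C ≤ 2 * seqRademacher (fun _ => ℓ) S C := by
  have := hS.to_subtype
  refine EReal.le_of_forall_lt_iff_le.1 fun r hr => ?_
  refine multiMinimax_le_of_playoutMean_le (ι := S) hℓ
    (fun m g => signLaw_mem_mixed g fun _ => hℓ) T C (fun π => π.1) (fun _ => 0) _ r
    (fun fs zs B hB => regret_le hB) fun w hw z σ => ?_
  refine playoutMean_zero_le (d := fun π => π) hr.le ?_ σ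
  exact le_iSup₂_of_le w hw (le_iSup_of_le z le_rfl)

/-- The first round only reveals an outcome `x`. The playout bound applies to the other `n` rounds
with comparators `π.after x`, and `x` becomes the root of the history. -/
theorem value_freeFirst_le_two_mul_seqRademacherFreeFirst [MeasurableSpace F] {ℓ : F → Z → ℝ}
    (hℓ : ∀ z, Measurable fun f => ℓ f z) {S : Set (Strategy F Z (n + 1))} (hS : S.Nonempty)
    (C : Constraints Z (n + 1)) :
    value (freeFirst ℓ) S C ≤ 2 * seqRademacherFreeFirst ℓ S C := by
  have := hS.to_subtype
  have hmeas : ∀ t z, Measurable fun f => freeFirst (n := n) ℓ t f z := fun t z =>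
    Fin.cases measurable_const (fun _ => hℓ z) t
  refine EReal.le_of_forall_lt_iff_le.1 fun r hr => ?_
  rw [value, multiMinimax]
  -- The first decision costs nothing; any point mass will do.
  refine (iInf₂_le (signLaw fun _ : Fin 0 → Bool => hS.some.first)
    (signLaw_mem_mixed _ hmeas)).trans (iSup₂_le fun x hx => ?_)
  refine (expect_mono _ fun f => ?_).trans
    ((expect_coe (integrable_const r)).trans (by simp)).le
  refine multiMinimax_le_of_playoutMean_le (ι := S) hℓ
    (fun m g => signLaw_mem_mixed g hmeas) n (C.after x) (fun π => π.1.after x) (fun _ => 0) _ r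
    (fun fs zs B hB => ?_) fun w hw z σ => ?_
  · refine (regret_le (B := B) fun π => ?_).trans (le_of_eq ?_)
    · have := hB π
      simpa [cumLoss, freeFirst, Fin.sum_univ_succ, Strategy.play_cons_succ] using this
    · simp [cumLoss, freeFirst, Fin.sum_univ_succ]
  · refine playoutMean_zero_le (d := fun π : Strategy F Z (n + 1) => π.after x) hr.le ?_ σ
    refine le_iSup₂_of_le (w.withRoot x) (fun ε => ?_) (le_iSup_of_le z (le_of_eq ?_))
    · rw [HistoryTree.path_withRoot]
      exact Constraints.obeyed_cons hx (hw ε)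
    · simp only [HistoryTree.path_withRoot, Strategy.play_cons_succ]

end OnlineGame

end

theorem theorem1 {F Z : Type*} [MeasurableSpace F] (ℓ : F → Z → ℝ)
    (hℓ : ∀ z, Measurable fun f => ℓ f z) :
    -- unconstrained adversary, constrained adversary
    (∀ (T : ℕ) (S : Set (OnlineGame.Strategy F Z T)), S.Nonempty →
      OnlineGame.value (fun _ => ℓ) S (OnlineGame.unconstrained Z T)
          ≤ 2 * OnlineGame.seqRademacher (fun _ => ℓ) S (OnlineGame.unconstrained Z T) ∧
      ∀ C : OnlineGame.Constraints Z T,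
        OnlineGame.value (fun _ => ℓ) S C
          ≤ 2 * OnlineGame.seqRademacher (fun _ => ℓ) S C) ∧
    -- the same two bounds when no loss is suffered in the first round
    (∀ (n : ℕ) (S : Set (OnlineGame.Strategy F Z (n + 1))), S.Nonempty →
      OnlineGame.value (OnlineGame.freeFirst ℓ) S (OnlineGame.unconstrained Z (n + 1))
          ≤ 2 * OnlineGame.seqRademacherFreeFirst ℓ S (OnlineGame.unconstrained Z (n + 1)) ∧
      ∀ C : OnlineGame.Constraints Z (n + 1),
        OnlineGame.value (OnlineGame.freeFirst ℓ) S C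
          ≤ 2 * OnlineGame.seqRademacherFreeFirst ℓ S C) := by
  exact ⟨fun T S hS => ⟨OnlineGame.value_le_two_mul_seqRademacher hℓ hS _,
      OnlineGame.value_le_two_mul_seqRademacher hℓ hS⟩,
    fun n S hS => ⟨OnlineGame.value_freeFirst_le_two_mul_seqRademacherFreeFirst hℓ hS _,
      OnlineGame.value_freeFirst_le_two_mul_seqRademacherFreeFirst hℓ hS⟩⟩
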